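/- Let $d\ge 0$ be an integer, let $\varepsilon>0$, and let $\mathcal K$ be a complex Hilbert space. For a $d$-tuple $Z=(Z_1,\dots,Z_d)$ of $n\times n$ complex matrices put $\|Z\|=\max_i\|Z_i\|$ (operator norms), and for a word $\alpha=x_{i_1}\cdots x_{i_k}$ in the noncommuting letters $x_1,\dots,x_d$ put $Z^\alpha=Z_{i_1}\cdots Z_{i_k}$, $Z^{1}=I$ for the empty word $1$, and $\alpha^*=x_{i_k}\cdots x_{i_1}$. Let $B_{\mathbb C}(0,1+\varepsilon)$ be the set of all such tuples, of all sizes $n$, with $\|Z\|<1+\varepsilon$, and let $B_{\mathbb R}(0,1+\varepsilon)$ be the subset of the tuples of Hermitian matrices. For operators $A$ and matrices $M$ write $AM$ for $A\otimes M$. Let $c_\alpha\in\mathcal B(\mathcal K)$ be given for every word $\alpha$, and let $f$ be a function on $B_{\mathbb C}(0,1+\varepsilon)$, with $f(Z)\in\mathcal B(\mathcal K)\otimes M_n(\mathbb C)=\mathcal B(\mathcal K\otimes\mathbb C^n)$ for $Z$ of size $n$, such that $$f(Z)=\sum_\alpha c_\alpha Z^\alpha ,$$ where the series over all words converges absolutely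 at each point of $B_{\mathbb C}(0,1+\varepsilon)$ and uniformly on $B_{\mathbb C}(0,1+\varepsilon)$. Suppose that $f$ is matrix convex on $B_{\mathbb R}(0,1+\varepsilon)$, that is, $f(X)$ is self-adjoint for every $X\in B_{\mathbb R}(0,1+\varepsilon)$, and $f\left(\frac{A+B}{2}\right)\le\frac{f(A)+f(B)}{2}$ for all $A,B\in B_{\mathbb R}(0,1+\varepsilon)$ of the same size. Then the block matrix $[c_{\beta^*\alpha}]_{\alpha,\beta}$, where $\alpha,\beta$ range over all words of degree at least $1$, is positive semidefinite. Let $\mathcal H$ be the Hilbert space obtained (by dividing out the null vectors and completing) from the span of the symbols $\alpha\otimes v$, with $\alpha$ a word of degree at least $1$ and $v\in\mathcal K$, equipped with the semi-inner product $$\langle\alpha\otimes v,\beta\otimes w\rangle=w^*c_{\beta^*\alpha}v .$$ For each $i=1,\dots,d$, the formula $T_i(\alpha\otimes v)=x_i\alpha\otimes v$ defines a bounded self-adjoint operator on $\mathcal H$ with $\|T_i\|\le 1$, and $Q_iv=x_i\otimes v$ defines a bounded operator $Q_i:\mathcal K\to\mathcal H$. Moreover, there are a self-adjoint $a_0\in\mathcal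 B(\mathcal K)$ and a continuous real-linear map $L:\mathbb R^d\to\mathcal B(\mathcal K)$ with self-adjoint values, extended to tuples of matrices by $L(Z)=\sum_i L(e_i)Z_i$, such that for every $Z\in B_{\mathbb C}(0,1+\varepsilon)$ the operator $I-\sum_iT_iZ_i$ is invertible and $$f(Z)=a_0+L(Z)+\Big(\sum_i Q_iZ_i^*\Big)^*\Big(I-\sum_i T_iZ_i\Big)^{-1}\Big(\sum_i Q_iZ_i\Big).$$ -/

import Mathlib

noncomputable section

namespace Butterfly

open scoped Matrix.Norms.L2Operator

/-! ### Words, tuples of matrices and the balls -/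

/-- Words in the noncommuting letters `x_1, …, x_d`; the empty word `[]` is the unit `1`. -/
abbrev Word (d : ℕ) : Type := List (Fin d)

/-- The involution on words: it reverses the order of the letters. -/
def Word.adj {d : ℕ} (α : Word d) : Word d := List.reverse α

/-- The words of degree at least one. -/
abbrev PosWord (d : ℕ) : Type := {α : Word d // α ≠ []}

/-- The word `x_i`. -/
def PosWord.letter {d : ℕ} (i : Fin d) : PosWord d := ⟨[i], by simp⟩

/-- The word `x_i α`. -/
def PosWord.cons {d : ℕ} (i : Fin d) (α : PosWord d) : PosWord d := ⟨i :: α.1, by simp⟩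

/-- Level `n` of the matrix universe over `ℝ^d`: `d`-tuples of `n × n` complex matrices. -/
abbrev Tuple (d n : ℕ) : Type := Fin d → Matrix (Fin n) (Fin n) ℂ

/-- The monomial `Z^α`. -/
def monomial {d n : ℕ} (Z : Tuple d n) (α : Word d) : Matrix (Fin n) (Fin n) ℂ :=
  (α.map Z).prod

/-- Level `n` of the complex ball `B_ℂ(0, r)` over the operator system `ℝ^d`
(the self-adjoint diagonal matrices), so the norm of a tuple is the maximum of the operator norms
of its entries. -/
def complexBall (d : ℕ) (r : ℝ) (n : ℕ) : Set (Tuple d n) :=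
  {Z | ∀ i, ‖Z i‖ < r}

/-- Level `n` of the real ball `B_ℝ(0, r)`: the tuples of Hermitian matrices in the ball. -/
def realBall (d : ℕ) (r : ℝ) (n : ℕ) : Set (Tuple d n) :=
  {X | (∀ i, (X i).IsHermitian) ∧ ∀ i, ‖X i‖ < r}

/-! ### Matrices over `B(K)` -/

/-- The Hilbert space `K ⊗ ℂ^n`. -/
abbrev Amp (K : Type*) (n : ℕ) : Type _ := PiLp 2 (fun _ : Fin n => K)

section Operators

variable {K H : Type*} [NormedAddCommGroup K] [InnerProductSpace ℂ K]
  [NormedAddCommGroup H] [InnerProductSpace ℂ H]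

/-- The operator `A ⊗ Z : K ⊗ ℂ^n → H ⊗ ℂ^n`, that is the block matrix `[Z_{ij} A]`. -/
def tens {n : ℕ} (A : K →L[ℂ] H) (Z : Matrix (Fin n) (Fin n) ℂ) : Amp K n →L[ℂ] Amp H n :=
  ((PiLp.continuousLinearEquiv 2 ℂ (fun _ : Fin n => H)).symm :
      (Fin n → H) →L[ℂ] Amp H n) ∘L
    ContinuousLinearMap.pi fun i =>
      ∑ j, Z i j • (A ∘L PiLp.proj 2 (𝕜 := ℂ) (fun _ : Fin n => K) j)

theorem tens_apply {n : ℕ} (A : K →L[ℂ] H) (Z : Matrix (Fin n) (Fin n) ℂ) (x : Amp K n)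
    (i : Fin n) : tens A Z x i = ∑ j, Z i j • A (x j) := by
  simp [tens]

/-- A graded function: it sends a `d`-tuple of `n × n` matrices to an `n × n` matrix over
`B(K)`, that is an operator on `K ⊗ ℂ^n`. -/
abbrev GradedFun (d : ℕ) (K : Type*) [NormedAddCommGroup K] [InnerProductSpace ℂ K] : Type _ :=
  ∀ n : ℕ, Tuple d n → (Amp K n →L[ℂ] Amp K n)

/-- The power series `∑ c_α Z^α` over all words converges to `f`, absolutely at each point of
`B_ℂ(0, r)` and uniformly on `B_ℂ(0, r)` (over all matrix sizes at once). -/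
def ConvergesAbsUnif {d : ℕ} (c : Word d → K →L[ℂ] K) (f : GradedFun d K) (r : ℝ) : Prop :=
  (∀ n, ∀ Z ∈ complexBall d r n, Summable fun α : Word d => ‖tens (c α) (monomial Z α)‖) ∧
  ∀ η : ℝ, 0 < η → ∃ F₀ : Finset (Word d), ∀ F : Finset (Word d), F₀ ⊆ F →
    ∀ n, ∀ Z ∈ complexBall d r n, ‖f n Z - ∑ α ∈ F, tens (c α) (monomial Z α)‖ < η

/-- `f` is matrix convex on `G`: it takes self-adjoint values and is midpoint convex at each
level, with respect to the Loewner order on operators. -/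
def MatrixConvexOn {d : ℕ} [CompleteSpace K] (G : ∀ n, Set (Tuple d n)) (f : GradedFun d K) :
    Prop :=
  (∀ n, ∀ X ∈ G n, IsSelfAdjoint (f n X)) ∧
  ∀ n, ∀ A ∈ G n, ∀ B ∈ G n,
    f n ((2⁻¹ : ℂ) • (A + B)) ≤ (2⁻¹ : ℂ) • (f n A + f n B)

end Operators

/-! ### The Hilbert space of the block matrix `[c_{β* α}]` -/

section HilbertSpace

variable {d : ℕ} {K : Type*} [NormedAddCommGroup K] [InnerProductSpace ℂ K]

/-- The sesquilinear form (conjugate linear in the first variable) on finite sums of symbols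
`α ⊗ v` that is determined by `⟨β ⊗ w, α ⊗ v⟩ = ⟨w, c_{β* α} v⟩`. -/
def form (c : Word d → K →L[ℂ] K) (ξ η : PosWord d →₀ K) : ℂ :=
  ξ.sum fun β w => η.sum fun α v => inner ℂ w (c (β.1.adj ++ α.1) v)

/-- The block matrix `[c_{β* α}]`, indexed by the words of degree at least one, is positive
semidefinite. -/
structure IsPositiveKernel [CompleteSpace K] (c : Word d → K →L[ℂ] K) : Prop where
  hermitian : ∀ α β : PosWord d,
    ContinuousLinearMap.adjoint (c (β.1.adj ++ α.1)) = c (α.1.adj ++ β.1)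
  nonneg : ∀ ξ : PosWord d →₀ K, 0 ≤ (form c ξ ξ).re

theorem form_add_left (c : Word d → K →L[ℂ] K) (ξ ξ' η : PosWord d →₀ K) :
    form c (ξ + ξ') η = form c ξ η + form c ξ' η := by
  unfold form
  apply Finsupp.sum_add_index'
  · intro β; simp
  · intro β w w'; simp only [inner_add_left, Finsupp.sum_add]

theorem form_smul_left (c : Word d → K →L[ℂ] K) (ξ η : PosWord d →₀ K) (r : ℂ) :
    form c (r • ξ) η = (starRingEnd ℂ) r * form c ξ η := by
  unfold form
  rw [Finsupp.sum_smul_index' (by intro β; simp)]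
  simp only [inner_smul_left, Finsupp.sum, Finset.mul_sum]

variable [CompleteSpace K] {c : Word d → K →L[ℂ] K}

theorem IsPositiveKernel.form_conj (h : IsPositiveKernel c) (ξ η : PosWord d →₀ K) :
    (starRingEnd ℂ) (form c η ξ) = form c ξ η := by
  unfold form
  simp only [Finsupp.sum, map_sum, inner_conj_symm]
  rw [Finset.sum_comm]
  refine Finset.sum_congr rfl fun β _ => Finset.sum_congr rfl fun α _ => ?_
  rw [← h.hermitian α β, ContinuousLinearMap.adjoint_inner_left]

/-- Finite sums of symbols `α ⊗ v` with `α` of degree at least one and `v ∈ K`, to be equipped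
with the semi-inner product `form c`. -/
def PreSpace (_ : IsPositiveKernel c) : Type _ := PosWord d →₀ K

variable (h : IsPositiveKernel c)

instance : AddCommGroup (PreSpace h) := inferInstanceAs (AddCommGroup (PosWord d →₀ K))
instance : Module ℂ (PreSpace h) := inferInstanceAs (Module ℂ (PosWord d →₀ K))

/-- The semi-inner product. -/
abbrev preCore : PreInnerProductSpace.Core ℂ (PreSpace h) where
  inner ξ η := form c ξ η
  conj_inner_symm ξ η := h.form_conj ξ η
  re_inner_nonneg ξ := h.nonneg ξ
  add_left ξ ξ' η := form_add_left c ξ ξ' η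
  smul_left ξ η r := form_smul_left c ξ η r

instance : SeminormedAddCommGroup (PreSpace h) :=
  InnerProductSpace.Core.toSeminormedAddCommGroup (c := preCore h)
instance : InnerProductSpace ℂ (PreSpace h) := InnerProductSpace.ofCore (preCore h)

/-- The Hilbert space: the (Hausdorff) completion, in which null vectors are identified
with zero. -/
abbrev Space : Type _ := UniformSpace.Completion (PreSpace h)

/-- The vector `α ⊗ v` of the Hilbert space. -/
def vec (α : PosWord d) (v : K) : Space h :=
  ((show PreSpace h from Finsupp.single α v : PreSpace h) : Space h)

theorem inner_vec (α β : PosWord d) (v w : K) :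
    inner ℂ (vec h β w) (vec h α v) = inner ℂ w (c (β.1.adj ++ α.1) v) := by
  unfold vec
  rw [UniformSpace.Completion.inner_coe]
  change form c (Finsupp.single β w) (Finsupp.single α v) = _
  simp [form]

end HilbertSpace

end Butterfly

end

open Butterfly

/-! Positivity comes from testing convexity on truncated Fock space. On the span of the words of
length at most `N`, the Hermitian tuple `fock θ` appends or removes a last letter, and its edges at
the vacuum carry weight `θ`. Its value at `θ = 0` is the midpoint of its values at `θ = ±1`, so
convexity makes the gap of `f` at these tuples, scaled by `s`, positive. For nonempty words `a`,
`b`, the gap entry at `(a, b)` only sees walks through the vacuum. The unique shortest one spells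
`a* b` and has weight `θ² = 1`, so the leading term is `s^(|a|+|b|) c_{a* b}`. Rescaling the basis
vector of `a` by `s^(-|a|)` and letting `s → 0` gives the kernel (`monomial_fock_sub`,
`form_re_nonneg`).

Contractivity comes from moments. If `A` is symmetric, the norms of `A^k ξ` are logarithmically
convex, so bounded moments `⟨ξ, A^k ξ⟩` force `‖A ξ‖ ≤ ‖ξ‖`. For left multiplication by `x_i` the
moments are bounded because the coefficients are; this also makes the operator well defined modulo
null vectors. The same principle applied to `P* P`, with `P = ∑ T_i ⊗ Z_i`, bounds the pencil: its
moments are dominated by the convergent series `∑ ‖c_α‖ ρ^|α|` (`norm_pencil_le_one`), and room in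
the open ball makes the bound strict.

The inverse is then a Neumann series. Its `k`-th term between the two `Q` factors is the degree `k +
2` part of `f`, because `Q_i* T^w Q_j = c_{x_i w x_j}`. Degrees zero and one provide `a₀` and `L`.
-/

noncomputable section

namespace Butterfly

open scoped Matrix.Norms.L2Operator
open Filter Topology

/-! ### Algebra of the amplifications `A ⊗ Z` -/

section Tens

variable {K H G : Type*} [NormedAddCommGroup K] [InnerProductSpace ℂ K]
  [NormedAddCommGroup H] [InnerProductSpace ℂ H] [NormedAddCommGroup G] [InnerProductSpace ℂ G]
  {n : ℕ}

theorem tens_comp (A : H →L[ℂ] G) (B : K →L[ℂ] H) (Z W : Matrix (Fin n) (Fin n) ℂ) :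
    tens A Z ∘L tens B W = tens (A ∘L B) (Z * W) := by
  ext x i
  simp only [ContinuousLinearMap.comp_apply, tens_apply, map_sum, map_smul, Matrix.mul_apply,
    Finset.sum_smul, Finset.smul_sum, smul_smul]
  rw [Finset.sum_comm]

theorem tens_smul_right (A : K →L[ℂ] H) (s : ℂ) (Z : Matrix (Fin n) (Fin n) ℂ) :
    tens A (s • Z) = s • tens A Z := by
  ext x i
  simp [tens_apply, Finset.smul_sum, smul_smul]

theorem tens_one : tens (1 : K →L[ℂ] K) (1 : Matrix (Fin n) (Fin n) ℂ) = 1 := by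
  ext x i
  simp [tens_apply, Matrix.one_apply, ite_smul]

theorem adjoint_tens [CompleteSpace K] [CompleteSpace H] (A : K →L[ℂ] H)
    (Z : Matrix (Fin n) (Fin n) ℂ) :
    ContinuousLinearMap.adjoint (tens A Z) =
      tens (ContinuousLinearMap.adjoint A) Z.conjTranspose := by
  symm
  rw [ContinuousLinearMap.eq_adjoint_iff]
  intro x y
  simp only [PiLp.inner_apply, tens_apply, sum_inner, inner_sum, inner_smul_left, inner_smul_right,
    Matrix.conjTranspose_apply, ContinuousLinearMap.adjoint_inner_left]
  rw [Finset.sum_comm]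
  simp

theorem inner_single_tens_single (A : K →L[ℂ] H) (Z : Matrix (Fin n) (Fin n) ℂ) (a b : Fin n)
    (v : H) (w : K) :
    inner ℂ (PiLp.single 2 a v : Amp H n) (tens A Z (PiLp.single 2 b w)) =
      Z a b * inner ℂ v (A w) := by
  rw [PiLp.inner_apply, Finset.sum_eq_single a]
  · rw [tens_apply, Finset.sum_eq_single b]
    · simp [inner_smul_right]
    · intro j _ hj
      rw [PiLp.single_eq_of_ne 2 hj, map_zero, smul_zero]
    · simp
  · intro j _ hj
    rw [PiLp.single_eq_of_ne 2 hj, inner_zero_left]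
  · simp

end Tens

/-! ### Monomials in matrix tuples -/

section Monomial

variable {d n : ℕ}

@[simp] theorem monomial_nil (Z : Tuple d n) : monomial Z [] = 1 := rfl

@[simp] theorem monomial_cons (Z : Tuple d n) (i : Fin d) (α : Word d) :
    monomial Z (i :: α) = Z i * monomial Z α := by simp [monomial]

theorem monomial_append (Z : Tuple d n) (α β : Word d) :
    monomial Z (α ++ β) = monomial Z α * monomial Z β := by simp [monomial]

theorem monomial_smul (s : ℂ) (Z : Tuple d n) (α : Word d) :
    monomial (s • Z) α = s ^ α.length • monomial Z α := by
  induction α with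
  | nil => simp
  | cons i α ih => simp [ih, smul_smul, pow_succ]

theorem monomial_reverse_apply {Z : Tuple d n} (hZ : ∀ i, (Z i).transpose = Z i) (α : Word d)
    (a b : Fin n) : monomial Z α.reverse a b = monomial Z α b a := by
  have : monomial Z α.reverse = (monomial Z α).transpose := by
    induction α with
    | nil => simp
    | cons i α ih => simp [monomial_append, ih, hZ]
  rw [this, Matrix.transpose_apply]

end Monomial

/-! ### Entries and coefficient bounds of the power series -/

section Series

variable {d : ℕ} {K : Type*} [NormedAddCommGroup K] [InnerProductSpace ℂ K]
  {c : Word d → K →L[ℂ] K} {f : GradedFun d K} {r : ℝ}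

theorem ConvergesAbsUnif.hasSum (h : ConvergesAbsUnif c f r) {n : ℕ} {Z : Tuple d n}
    (hZ : Z ∈ complexBall d r n) :
    HasSum (fun α => tens (c α) (monomial Z α)) (f n Z) := by
  rw [HasSum, SummationFilter.unconditional_filter]
  refine (Metric.tendsto_atTop (α := Amp K n →L[ℂ] Amp K n) (β := Finset (Word d))).2 fun η hη => ?_
  obtain ⟨F₀, hF⟩ := h.2 η hη
  refine ⟨F₀, fun F hFF => ?_⟩
  rw [dist_comm]
  exact (dist_eq_norm (f n Z) _).trans_lt (hF F hFF n Z hZ)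

theorem ConvergesAbsUnif.hasSum_entry (h : ConvergesAbsUnif c f r) {n : ℕ} {Z : Tuple d n}
    (hZ : Z ∈ complexBall d r n) (a b : Fin n) (v w : K) :
    HasSum (fun α => monomial Z α a b * inner ℂ v (c α w))
      (inner ℂ (PiLp.single 2 a v : Amp K n) (f n Z (PiLp.single 2 b w))) := by
  have h1 := (h.hasSum hZ).mapL
    (ContinuousLinearMap.apply ℂ (Amp K n) (PiLp.single 2 b w : Amp K n))
  have h2 := h1.mapL (innerSL ℂ (PiLp.single 2 a v : Amp K n))
  simpa only [ContinuousLinearMap.apply_apply, innerSL_apply_apply, inner_single_tens_single]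
    using h2

theorem ConvergesAbsUnif.summable_entry (h : ConvergesAbsUnif c f r) {n : ℕ} {Z : Tuple d n}
    (hZ : Z ∈ complexBall d r n) (a b : Fin n) (v w : K) :
    Summable fun α => ‖monomial Z α a b * inner ℂ v (c α w)‖ := by
  refine Summable.of_nonneg_of_le (fun _ => norm_nonneg _) (fun α => ?_)
    (((h.1 n Z hZ).mul_left ‖v‖).mul_right ‖w‖)
  rw [← inner_single_tens_single]
  refine (norm_inner_le_norm _ _).trans ?_
  rw [PiLp.norm_single, mul_assoc]
  gcongr
  exact (ContinuousLinearMap.le_opNorm _ _).trans (by rw [PiLp.norm_single])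

theorem norm_tens_of_fin_one (A : K →L[ℂ] K) (z : ℂ) :
    ‖A‖ * ‖z‖ ≤ ‖tens A (Matrix.of fun _ _ : Fin 1 => z)‖ := by
  rw [mul_comm, ← norm_smul]
  refine ContinuousLinearMap.opNorm_le_bound _ (by positivity) fun v => ?_
  have h := (tens A (Matrix.of fun _ _ : Fin 1 => z)).le_opNorm (PiLp.single 2 0 v)
  rw [PiLp.norm_single] at h
  refine le_trans (le_of_eq ?_) h
  have : tens A (Matrix.of fun _ _ : Fin 1 => z) (PiLp.single 2 0 v) =
      PiLp.single 2 0 ((z • A) v) := by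
    ext i
    fin_cases i
    simp [tens_apply]
  rw [this, PiLp.norm_single]

/-- Scalar tuples detect the norms of the coefficients. -/
theorem ConvergesAbsUnif.summable_norm (h : ConvergesAbsUnif c f r) {ρ : ℝ} (h0 : 0 ≤ ρ)
    (hρ : ρ < r) : Summable fun α => ‖c α‖ * ρ ^ α.length := by
  let Z : Tuple d 1 := fun _ => Matrix.of fun _ _ => (ρ : ℂ)
  have hZ' : ∀ i, Z i = (ρ : ℂ) • (1 : Matrix (Fin 1) (Fin 1) ℂ) := by
    intro i
    ext a b
    simp [Z, Subsingleton.elim a b]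
  have hm : ∀ α, monomial Z α = Matrix.of fun _ _ => (ρ : ℂ) ^ α.length := by
    intro α
    induction α with
    | nil => ext a b; simp [Subsingleton.elim a b]
    | cons i α ih => ext a b; simp [ih, hZ', pow_succ']
  have hZ : Z ∈ complexBall d r 1 := by
    intro i
    rw [hZ' i, norm_smul]
    simpa [abs_of_nonneg h0] using hρ
  refine Summable.of_nonneg_of_le (fun _ => by positivity) (fun α => ?_) (h.1 1 Z hZ)
  rw [hm]
  simpa [abs_of_nonneg h0] using norm_tens_of_fin_one (c α) ((ρ : ℂ) ^ α.length)

end Series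

/-- The leading coefficient of a noncommutative power series along a ray. -/
theorem tendsto_leading_coeff {d : ℕ} {a : Word d → ℂ} {s₀ : ℝ} (hs₀ : 0 < s₀)
    (ha : Summable fun w => ‖a w‖ * s₀ ^ w.length) {w₀ : Word d}
    (h0 : ∀ w, w.length ≤ w₀.length → w ≠ w₀ → a w = 0) :
    Tendsto (fun s : ℝ => ((s : ℂ) ^ w₀.length)⁻¹ * ∑' w, (s : ℂ) ^ w.length * a w)
      (𝓝[>] 0) (𝓝 (a w₀)) := by
  classical
  -- The natural subtraction truncates only for words shorter than `w₀`, whose coefficients vanish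
  -- by `h0`. In the limit `s = 0` only exponent zero survives, and among those words only `w₀` has
  -- a nonzero coefficient.
  have key : Tendsto (fun s : ℝ => ∑' w, (s : ℂ) ^ (w.length - w₀.length) * a w)
      (𝓝[>] 0) (𝓝 (∑' w, if w = w₀ then a w else 0)) := by
    refine tendsto_tsum_of_dominated_convergence
      (bound := fun w => ‖a w‖ * s₀ ^ w.length * (s₀ ^ w₀.length)⁻¹) (ha.mul_right _) ?_ ?_
    · intro w
      have hc : Tendsto (fun s : ℝ => (s : ℂ) ^ (w.length - w₀.length) * a w) (𝓝[>] 0)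
          (𝓝 (((0 : ℝ) : ℂ) ^ (w.length - w₀.length) * a w)) := by
        apply Tendsto.mono_left _ nhdsWithin_le_nhds
        exact Continuous.tendsto (by fun_prop) 0
      convert hc using 2
      by_cases hw : w = w₀
      · simp [hw]
      · rw [if_neg hw]
        by_cases hl : w.length ≤ w₀.length
        · simp [h0 w hl hw]
        · have : w.length - w₀.length ≠ 0 := by omega
          simp [this]
    · have hev : ∀ᶠ s : ℝ in 𝓝[>] 0, s < s₀ := nhdsWithin_le_nhds (gt_mem_nhds hs₀)
      filter_upwards [hev, self_mem_nhdsWithin] with s hs hs' w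
      have hs' : 0 < s := hs'
      by_cases hl : w.length < w₀.length
      · rw [h0 w hl.le (by rintro rfl; exact lt_irrefl _ hl)]
        simp
      · have e : s₀ ^ w.length * (s₀ ^ w₀.length)⁻¹ = s₀ ^ (w.length - w₀.length) := by
          rw [pow_sub₀ _ hs₀.ne' (by omega)]
        rw [mul_assoc, e, norm_mul, mul_comm]
        gcongr
        simp only [norm_pow, Complex.norm_real, Real.norm_eq_abs, abs_of_pos hs']
        gcongr
  simp only [tsum_ite_eq] at key
  refine key.congr' ?_
  filter_upwards [self_mem_nhdsWithin] with s hs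
  have hs : 0 < s := hs
  have hs' : (s : ℂ) ≠ 0 := by exact_mod_cast hs.ne'
  rw [← tsum_mul_left]
  refine tsum_congr fun w => ?_
  by_cases hl : w.length < w₀.length
  · rw [h0 w hl.le (by rintro rfl; exact lt_irrefl _ hl)]
    simp
  · rw [pow_sub₀ _ hs' (by omega)]
    ring

/-! ### Truncated Fock space matrices -/

/-- An enumeration of the words of length at most `N`. -/
structure WordEnum (d N n : ℕ) where
  /-- The word with a given index. -/
  word : Fin n → Word d
  injective : Function.Injective word
  length_le : ∀ a, (word a).length ≤ N
  exists_word : ∀ v : Word d, v.length ≤ N → ∃ a, word a = v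

theorem exists_wordEnum (d N : ℕ) : ∃ n, Nonempty (WordEnum d N n) := by
  have : Finite {l : List (Fin d) | l.length ≤ N} := List.finite_length_le (Fin d) N
  obtain ⟨n, ⟨e⟩⟩ := Finite.exists_equiv_fin {l : List (Fin d) | l.length ≤ N}
  refine ⟨n, ⟨fun a => (e.symm a).1, ?_, fun a => (e.symm a).2, fun v hv => ⟨e ⟨v, hv⟩, by simp⟩⟩⟩
  exact Subtype.val_injective.comp e.symm.injective

namespace WordEnum

variable {d N n : ℕ} (u : WordEnum d N n)

/-- The tuple of compressed right creation operators plus their adjoints; the matrix entries that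
involve the vacuum carry the extra factor `θ`. -/
def fock (θ : ℝ) : Tuple d n := fun i => Matrix.of fun a c =>
  if u.word c = u.word a ++ [i] ∨ u.word a = u.word c ++ [i] then
    (if u.word a = [] ∨ u.word c = [] then (θ : ℂ) else 1) else 0

theorem fock_apply (θ : ℝ) (i : Fin d) (a c : Fin n) : u.fock θ i a c =
    if u.word c = u.word a ++ [i] ∨ u.word a = u.word c ++ [i] then
    (if u.word a = [] ∨ u.word c = [] then (θ : ℂ) else 1) else 0 := rfl

theorem fock_transpose (θ : ℝ) (i : Fin d) : (u.fock θ i).transpose = u.fock θ i := by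
  ext a c
  simp only [Matrix.transpose_apply, fock_apply, or_comm]

theorem fock_isHermitian (θ : ℝ) (i : Fin d) : (u.fock θ i).IsHermitian := by
  ext a c
  rw [Matrix.conjTranspose_apply, ← Matrix.transpose_apply (u.fock θ i) a c, fock_transpose,
    fock_apply]
  split_ifs <;> simp

/-- The entries are affine in `θ`. This is the midpoint at which convexity is tested. -/
theorem fock_zero_eq : u.fock 0 = (2⁻¹ : ℂ) • (u.fock 1 + u.fock (-1)) := by
  ext i a c
  simp only [Pi.smul_apply, Pi.add_apply, Matrix.smul_apply, Matrix.add_apply, fock_apply,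
    smul_eq_mul]
  split_ifs <;> norm_num

theorem monomial_cons_apply (Z : Tuple d n) (i : Fin d) (w : Word d) (a b : Fin n) :
    monomial Z (i :: w) a b = ∑ c, Z i a c * monomial Z w c b := by
  rw [monomial_cons, Matrix.mul_apply]

/-- An entry of a monomial is a weighted count of walks that read the letters in order. With no
steps to spare, a walk from `a` to `b` must append a letter at every step, and it meets the vacuum
at most at its start. -/
theorem monomial_fock_outward (θ : ℝ) (w : Word d) (a b : Fin n)
    (h : w.length + (u.word a).length ≤ (u.word b).length) :
    monomial (u.fock θ) w a b = if u.word b = u.word a ++ w then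
      (if u.word a = [] ∧ u.word b ≠ [] then (θ : ℂ) else 1) else 0 := by
  induction w generalizing a with
  | nil =>
    rw [monomial_nil, Matrix.one_apply, List.append_nil]
    by_cases hab : a = b
    · subst hab
      simp
    · rw [if_neg hab, if_neg (fun h' => hab (u.injective h'.symm))]
  | cons i w ih =>
    rw [List.length_cons] at h
    rw [monomial_cons_apply]
    obtain ⟨c, hc⟩ := u.exists_word (u.word a ++ [i])
      (by have := u.length_le b; simp; omega)
    rw [Finset.sum_eq_single c]
    · rw [ih c (by rw [hc]; simp; omega), fock_apply, hc]
      simp only [List.append_assoc, List.cons_append, List.nil_append, true_or, if_true]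
      by_cases hb : u.word b = u.word a ++ i :: w
      · by_cases ha : u.word a = []
        · simp [hb, ha]
        · simp [hb, ha]
      · simp [hb]
    · intro c' _ hc'
      rw [fock_apply]
      split_ifs with h1 h2
      all_goals try simp
      all_goals
        rcases h1 with h1 | h1
        · exact absurd (u.injective (h1.trans hc.symm)) hc'
        · have hl := congrArg List.length h1
          simp only [List.length_append, List.length_cons, List.length_nil] at hl
          rw [ih c' (by omega), if_neg]
          try simp
          intro h3
          have hl3 := congrArg List.length h3
          simp only [List.length_append] at hl3
          omega
    · simp

/-- At `θ = 0` the vacuum is an isolated vertex. -/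
theorem monomial_fock_zero_vacuum (w : Word d) (a b : Fin n) (ha : u.word a = [])
    (hb : u.word b ≠ []) : monomial (u.fock 0) w a b = 0 := by
  cases w with
  | nil => exact Matrix.one_apply_ne (by rintro rfl; exact hb ha)
  | cons i w =>
    rw [monomial_cons_apply]
    refine Finset.sum_eq_zero fun c _ => ?_
    simp [fock_apply, ha]

/-- The shortest walks through the vacuum. -/
theorem monomial_fock_sub (θ : ℝ) (w : Word d) (a b : Fin n) (hb : u.word b ≠ [])
    (h : w.length ≤ (u.word a).length + (u.word b).length) :
    monomial (u.fock θ) w a b - monomial (u.fock 0) w a b =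
      if w = (u.word a).reverse ++ u.word b then
      (if u.word a = [] then (θ : ℂ) else (θ : ℂ) ^ 2) else 0 := by
  induction w generalizing a with
  | nil => simp [hb]
  | cons i w ih =>
    rw [List.length_cons] at h
    -- Telescoping over the first step: either the change in `θ` is felt later in the walk, or it is
    -- felt at this edge and the rest avoids the vacuum.
    have split : monomial (u.fock θ) (i :: w) a b - monomial (u.fock 0) (i :: w) a b =
        ∑ c, u.fock θ i a c * (monomial (u.fock θ) w c b - monomial (u.fock 0) w c b) +
        ∑ c, (u.fock θ i a c - u.fock 0 i a c) * monomial (u.fock 0) w c b := by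
      rw [monomial_cons_apply, monomial_cons_apply, ← Finset.sum_sub_distrib,
        ← Finset.sum_add_distrib]
      exact Finset.sum_congr rfl fun c _ => by ring
    rw [split]
    by_cases ha : u.word a = []
    · rw [ha] at h ⊢
      obtain ⟨c, hc⟩ := u.exists_word [i] (by
        have := u.length_le b
        have := List.length_pos_iff.2 hb
        simp; omega)
      -- Starting at the vacuum, a walk that returns to it is too long to end at `b`. What remains
      -- is one edge of weight `θ` followed by an outward walk.
      rw [Finset.sum_eq_zero, zero_add, Finset.sum_eq_single c]
      · rw [u.monomial_fock_outward 0 w c b (by rw [hc]; simp at h ⊢; omega), fock_apply,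
          fock_apply, hc, ha]
        by_cases hw : i :: w = u.word b
        · simp [← hw]
        · simp [hw, Ne.symm hw]
      · intro c' _ hc'
        have : u.word c' ≠ [i] := fun h' => hc' (u.injective (h'.trans hc.symm))
        simp [fock_apply, ha, this]
      · simp
      · intro c' _
        by_cases h1 : u.word c' = [i]
        · rw [mul_eq_zero, ih c' (by simp at h; omega)]
          refine Or.inr (if_neg fun h' => ?_)
          have := congrArg List.length h'
          simp [h1] at this h
          omega
        · simp [fock_apply, ha, h1]
    · rw [if_neg ha, Finset.sum_eq_zero (s := Finset.univ)
        (f := fun c => (u.fock θ i a c - u.fock 0 i a c) * monomial (u.fock 0) w c b), add_zero]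
      swap
      · intro c _
        by_cases hc : u.word c = []
        · rw [u.monomial_fock_zero_vacuum w c b hc hb, mul_zero]
        · simp [fock_apply, ha, hc]
      -- Moving away from the vacuum first leaves too few steps to pass through it and reach `b`;
      -- only removing the last letter of `a` can contribute.
      have key : ∀ c, u.word a ≠ u.word c ++ [i] →
          u.fock θ i a c * (monomial (u.fock θ) w c b - monomial (u.fock 0) w c b) = 0 := by
        intro c hc
        by_cases h1 : u.word c = u.word a ++ [i]
        · rw [mul_eq_zero, ih c (by rw [h1]; simp; omega)]
          refine Or.inr (if_neg fun h' => ?_)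
          have := congrArg List.length h'
          simp [h1] at this
          omega
        · simp [fock_apply, h1, hc]
      obtain ⟨v, j, hv⟩ := (List.eq_nil_or_concat' (u.word a)).resolve_left ha
      by_cases hij : i = j
      · subst hij
        have hl := congrArg List.length hv
        obtain ⟨c, hc⟩ := u.exists_word v (by have := u.length_le a; simp at hl; omega)
        rw [Finset.sum_eq_single c]
        · rw [ih c (by rw [hc]; simp at hl; omega), fock_apply, hc, hv]
          by_cases hw : w = v.reverse ++ u.word b
          -- If `a` has one letter, this step enters the vacuum with weight `θ` and leaving it gives
          -- the second factor; otherwise induction already supplies `θ²`.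
          · by_cases hv' : v = []
            · simp [hw, hv', pow_two]
            · simp [hw, hv']
          · simp [hw]
        · intro c' _ hc'
          apply key
          intro h'
          apply hc'
          apply u.injective
          rw [hv] at h'
          rw [hc]
          exact (List.append_cancel_right h').symm
        · simp
      · rw [Finset.sum_eq_zero, if_neg]
        · rw [hv]; simp [hij]
        · intro c _
          apply key
          rw [hv]
          intro h'
          exact hij (by simpa using (List.append_inj' h' rfl).2.symm)

end WordEnum

/-! ### The coefficients of a matrix convex series -/

theorem eventually_smul_mem_realBall {d n : ℕ} {r : ℝ} (hr : 0 < r) {Z : Tuple d n}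
    (hZ : ∀ i, (Z i).IsHermitian) :
    ∀ᶠ s : ℝ in 𝓝[>] 0, (s : ℂ) • Z ∈ realBall d r n := by
  have h : ∀ᶠ s : ℝ in 𝓝 0, ∀ i, ‖(s : ℂ) • Z i‖ < r := by
    refine eventually_all.2 fun i => ?_
    have : Tendsto (fun s : ℝ => |s| * ‖Z i‖) (𝓝 0) (𝓝 (|0| * ‖Z i‖)) :=
      Continuous.tendsto (by fun_prop) 0
    rw [abs_zero, zero_mul] at this
    filter_upwards [this.eventually (gt_mem_nhds hr)] with s hs
    rwa [norm_smul, Complex.norm_real, Real.norm_eq_abs]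
  filter_upwards [nhdsWithin_le_nhds h] with s hs
  refine ⟨fun i => ?_, hs⟩
  rw [Pi.smul_apply, Matrix.IsHermitian, Matrix.conjTranspose_smul, hZ i]
  simp

theorem realBall_subset_complexBall {d n : ℕ} {r : ℝ} : realBall d r n ⊆ complexBall d r n :=
  fun _ h => h.2

section Coefficients

variable {d n : ℕ} {K : Type*} [NormedAddCommGroup K] [InnerProductSpace ℂ K]
  {c : Word d → K →L[ℂ] K} {f : GradedFun d K} {r : ℝ}

theorem ConvergesAbsUnif.entry_eq_tsum (h : ConvergesAbsUnif c f r) {Z : Tuple d n} {s : ℂ}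
    (hZ : s • Z ∈ complexBall d r n) (a b : Fin n) (v w : K) :
    inner ℂ (PiLp.single 2 a v : Amp K n) (f n (s • Z) (PiLp.single 2 b w)) =
      ∑' α : Word d, s ^ α.length * (monomial Z α a b * inner ℂ v (c α w)) := by
  rw [← (h.hasSum_entry hZ a b v w).tsum_eq]
  refine tsum_congr fun α => ?_
  rw [monomial_smul, Matrix.smul_apply, smul_eq_mul, mul_assoc]

theorem ConvergesAbsUnif.summable_entry_pow (h : ConvergesAbsUnif c f r) {Z : Tuple d n} {s : ℝ}
    (hs : 0 < s) (hZ : (s : ℂ) • Z ∈ complexBall d r n) (a b : Fin n) (v w : K) :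
    Summable fun α : Word d => ‖monomial Z α a b * inner ℂ v (c α w)‖ * s ^ α.length := by
  refine (h.summable_entry hZ a b v w).congr fun α => ?_
  rw [monomial_smul, Matrix.smul_apply, smul_eq_mul, mul_assoc, norm_mul, norm_pow,
    Complex.norm_real, Real.norm_eq_abs, abs_of_pos hs, mul_comm]

theorem ConvergesAbsUnif.tendsto_entry (h : ConvergesAbsUnif c f r) (hr : 0 < r) {Z : Tuple d n}
    (hZ : ∀ i, (Z i).IsHermitian) (a b : Fin n) (v w : K) {α₀ : Word d}
    (h0 : ∀ α, α.length ≤ α₀.length → α ≠ α₀ → monomial Z α a b = 0) :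
    Tendsto (fun s : ℝ => ((s : ℂ) ^ α₀.length)⁻¹ *
        inner ℂ (PiLp.single 2 a v : Amp K n) (f n ((s : ℂ) • Z) (PiLp.single 2 b w)))
      (𝓝[>] 0) (𝓝 (monomial Z α₀ a b * inner ℂ v (c α₀ w))) := by
  have hev := eventually_smul_mem_realBall hr hZ
  obtain ⟨s₀, hs₀, hpos⟩ := (hev.and self_mem_nhdsWithin).exists
  refine (tendsto_leading_coeff (a := fun α => monomial Z α a b * inner ℂ v (c α w)) hpos
    (h.summable_entry_pow hpos (realBall_subset_complexBall hs₀) a b v w)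
    (fun α hα hne => by simp [h0 α hα hne])).congr' ?_
  filter_upwards [hev] with s hs
  rw [h.entry_eq_tsum (realBall_subset_complexBall hs)]

/-- The difference matters: the separate entries may have lower-order terms from walks avoiding the
vacuum, which cancel here. -/
theorem ConvergesAbsUnif.tendsto_entry_sub (h : ConvergesAbsUnif c f r) (hr : 0 < r)
    {Z W : Tuple d n} (hZ : ∀ i, (Z i).IsHermitian) (hW : ∀ i, (W i).IsHermitian)
    (a b : Fin n) (v w : K) {α₀ : Word d}
    (h0 : ∀ α, α.length ≤ α₀.length → α ≠ α₀ → monomial Z α a b - monomial W α a b = 0) :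
    Tendsto (fun s : ℝ => ((s : ℂ) ^ α₀.length)⁻¹ *
        inner ℂ (PiLp.single 2 a v : Amp K n)
          ((f n ((s : ℂ) • Z) - f n ((s : ℂ) • W)) (PiLp.single 2 b w)))
      (𝓝[>] 0) (𝓝 ((monomial Z α₀ a b - monomial W α₀ a b) * inner ℂ v (c α₀ w))) := by
  have hev := (eventually_smul_mem_realBall hr hZ).and (eventually_smul_mem_realBall hr hW)
  obtain ⟨s₀, ⟨hs₀, hs₀'⟩, hpos⟩ := (hev.and self_mem_nhdsWithin).exists
  have hpos : 0 < s₀ := hpos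
  refine (tendsto_leading_coeff
    (a := fun α => (monomial Z α a b - monomial W α a b) * inner ℂ v (c α w)) hpos
    (Summable.of_nonneg_of_le (fun _ => by positivity) (fun α => ?_)
      ((h.summable_entry_pow hpos (realBall_subset_complexBall hs₀) a b v w).add
      (h.summable_entry_pow hpos (realBall_subset_complexBall hs₀') a b v w)))
    (fun α hα hne => by simp [h0 α hα hne])).congr' ?_
  · rw [← add_mul, sub_mul]
    gcongr
    exact norm_sub_le _ _
  · filter_upwards [hev, self_mem_nhdsWithin] with s hs hs0
    have hs0 : 0 < s := hs0
    rw [_root_.sub_apply, inner_sub_right,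
      h.entry_eq_tsum (realBall_subset_complexBall hs.1),
      h.entry_eq_tsum (realBall_subset_complexBall hs.2), ← Summable.tsum_sub]
    · congr 1
      exact tsum_congr fun α => by ring
    · refine Summable.of_norm ((h.summable_entry_pow hs0
        (realBall_subset_complexBall hs.1) a b v w).congr fun α => ?_)
      rw [norm_mul _ (_ * _), norm_pow, Complex.norm_real, Real.norm_eq_abs, abs_of_pos hs0,
        mul_comm]
    · refine Summable.of_norm ((h.summable_entry_pow hs0
        (realBall_subset_complexBall hs.2) a b v w).congr fun α => ?_)
      rw [norm_mul _ (_ * _), norm_pow, Complex.norm_real, Real.norm_eq_abs, abs_of_pos hs0,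
        mul_comm]

variable [CompleteSpace K]

/-- Between the vacuum and `α`, the shortest walk spells `α` in one direction and its reversal in
the other. Comparing leading terms of the two mutually conjugate entries of `f` gives the identity.
-/
theorem coeff_adjoint (h : ConvergesAbsUnif c f r) (hr : 0 < r)
    (hf : ∀ n, ∀ X ∈ realBall d r n, IsSelfAdjoint (f n X)) (α : Word d) :
    ContinuousLinearMap.adjoint (c α) = c α.reverse := by
  obtain ⟨n, ⟨u⟩⟩ := exists_wordEnum d α.length
  obtain ⟨a, ha⟩ := u.exists_word [] (by simp)
  obtain ⟨b, hb⟩ := u.exists_word α le_rfl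
  have hm : ∀ β : Word d, β.length ≤ α.length →
      monomial (u.fock 1) β a b = if β = α then 1 else 0 := by
    intro β hβ
    rw [u.monomial_fock_outward 1 β a b (by simp [ha, hb, hβ]), ha, hb]
    simp [eq_comm]
  have hm' : ∀ β : Word d, β.length ≤ α.length →
      monomial (u.fock 1) β b a = if β = α.reverse then 1 else 0 := by
    intro β hβ
    rw [← monomial_reverse_apply (u.fock_transpose 1), hm _ (by simpa using hβ)]
    simp [List.reverse_eq_iff]
  symm
  rw [ContinuousLinearMap.eq_adjoint_iff]
  intro v w
  have t1 := h.tendsto_entry hr (u.fock_isHermitian 1) a b v w (α₀ := α)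
    (fun β hβ hne => by simp [hm β hβ, hne])
  have t2 := h.tendsto_entry hr (u.fock_isHermitian 1) b a w v (α₀ := α.reverse)
    (fun β hβ hne => by simp [hm' β (by simpa using hβ), hne])
  rw [hm α le_rfl, if_pos rfl, one_mul] at t1
  rw [hm' _ (by simp), if_pos rfl, one_mul] at t2
  have t3 := (Complex.continuous_conj.tendsto _).comp t2
  rw [inner_conj_symm] at t3
  refine tendsto_nhds_unique t3 (t1.congr' ?_)
  filter_upwards [eventually_smul_mem_realBall hr (u.fock_isHermitian 1)] with s hs
  have hsa := hf n _ hs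
  simp only [Function.comp_apply, map_mul, map_inv₀, map_pow, Complex.conj_ofReal,
    inner_conj_symm, List.length_reverse]
  congr 1
  rw [← ContinuousLinearMap.adjoint_inner_left, hsa.adjoint_eq]

theorem form_re_nonneg (h : ConvergesAbsUnif c f r) (hr : 0 < r)
    (hf : MatrixConvexOn (realBall d r) f) (ξ : PosWord d →₀ K) : 0 ≤ (form c ξ ξ).re := by
  obtain ⟨n, ⟨u⟩⟩ := exists_wordEnum d (ξ.support.sup fun p => p.1.length)
  obtain ⟨a₀, -⟩ := u.exists_word [] (by simp)
  have : Nonempty (Fin n) := ⟨a₀⟩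
  have hex : ∀ p ∈ ξ.support, ∃ a, u.word a = p.1 := fun p hp =>
    u.exists_word p.1 (Finset.le_sup (f := fun p : PosWord d => p.1.length) hp)
  choose! idx hidx using hex
  have hsub : ∀ θ : ℝ, θ ^ 2 = 1 → ∀ q ∈ ξ.support, ∀ p ∈ ξ.support,
      Tendsto (fun s : ℝ => ((s : ℂ) ^ (q.1.reverse ++ p.1).length)⁻¹ *
        inner ℂ (PiLp.single 2 (idx q) (ξ q) : Amp K n)
          ((f n ((s : ℂ) • u.fock θ) - f n ((s : ℂ) • u.fock 0)) (PiLp.single 2 (idx p) (ξ p))))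
      (𝓝[>] 0) (𝓝 (inner ℂ (ξ q) (c (q.1.reverse ++ p.1) (ξ p)))) := by
    intro θ hθ q hq p hp
    have hm : ∀ α : Word d, α.length ≤ (q.1.reverse ++ p.1).length →
        monomial (u.fock θ) α (idx q) (idx p) - monomial (u.fock 0) α (idx q) (idx p) =
          if α = q.1.reverse ++ p.1 then 1 else 0 := by
      intro α hα
      rw [u.monomial_fock_sub θ α _ _ (by rw [hidx p hp]; exact p.2)
        (by rw [hidx p hp, hidx q hq]; simpa using hα), hidx p hp, hidx q hq, if_neg q.2]
      rw [show (θ : ℂ) ^ 2 = 1 by exact_mod_cast hθ]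
    have := h.tendsto_entry_sub hr (u.fock_isHermitian θ) (u.fock_isHermitian 0) (idx q) (idx p)
      (ξ q) (ξ p) (α₀ := q.1.reverse ++ p.1) (fun α hα hne => by rw [hm α hα, if_neg hne])
    rwa [hm _ le_rfl, if_pos rfl, one_mul] at this
  -- The convexity gap, tested below on vectors whose component at a word `p` is scaled by
  -- `s^(-|p|)` to cancel the order of vanishing of each block.
  let D : ℝ → Amp K n →L[ℂ] Amp K n := fun s =>
    (2⁻¹ : ℂ) • (f n ((s : ℂ) • u.fock 1) + f n ((s : ℂ) • u.fock (-1))) -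
      f n ((s : ℂ) • u.fock 0)
  let ψ : ℝ → Amp K n := fun s =>
    ∑ p ∈ ξ.support, ((s : ℂ) ^ p.1.length)⁻¹ • PiLp.single 2 (idx p) (ξ p)
  have hlim : Tendsto (fun s => inner ℂ (ψ s) (D s (ψ s))) (𝓝[>] 0) (𝓝 (form c ξ ξ)) := by
    have hψ : ∀ s, inner ℂ (ψ s) (D s (ψ s)) = ∑ q ∈ ξ.support, ∑ p ∈ ξ.support,
        (2⁻¹ * (((s : ℂ) ^ (q.1.reverse ++ p.1).length)⁻¹ *
          inner ℂ (PiLp.single 2 (idx q) (ξ q) : Amp K n)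
          ((f n ((s : ℂ) • u.fock 1) - f n ((s : ℂ) • u.fock 0)) (PiLp.single 2 (idx p) (ξ p)))) +
        2⁻¹ * (((s : ℂ) ^ (q.1.reverse ++ p.1).length)⁻¹ *
          inner ℂ (PiLp.single 2 (idx q) (ξ q) : Amp K n)
          ((f n ((s : ℂ) • u.fock (-1)) - f n ((s : ℂ) • u.fock 0))
            (PiLp.single 2 (idx p) (ξ p))))) := by
      intro s
      simp only [ψ, map_sum, sum_inner, inner_sum, map_smul, inner_smul_left, inner_smul_right]
      rw [Finset.sum_comm]
      refine Finset.sum_congr rfl fun p _ => ?_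
      rw [Finset.mul_sum]
      refine Finset.sum_congr rfl fun q _ => ?_
      simp only [D, _root_.sub_apply, _root_.smul_apply,
        _root_.add_apply, inner_sub_right, inner_smul_right, inner_add_right,
        map_inv₀, map_pow, Complex.conj_ofReal, List.length_append, List.length_reverse, pow_add,
        mul_inv]
      ring
    simp only [hψ]
    unfold form Finsupp.sum
    refine tendsto_finsetSum _ fun q hq => tendsto_finsetSum _ fun p hp => ?_
    have := ((hsub 1 (by norm_num) q hq p hp).const_mul 2⁻¹).add
      ((hsub (-1) (by norm_num) q hq p hp).const_mul 2⁻¹)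
    convert this using 2
    rw [← add_mul]
    norm_num [Word.adj]
  refine ge_of_tendsto ((Complex.continuous_re.tendsto _).comp hlim) ?_
  filter_upwards [eventually_smul_mem_realBall hr (u.fock_isHermitian 1),
    eventually_smul_mem_realBall hr (u.fock_isHermitian (-1))] with s h1 h2
  have h3 := hf.2 n _ h1 _ h2
  rw [← smul_add, smul_comm, ← u.fock_zero_eq, ContinuousLinearMap.le_def] at h3
  exact h3.re_inner_nonneg_right (ψ s)

theorem isPositiveKernel (h : ConvergesAbsUnif c f r) (hr : 0 < r)
    (hf : MatrixConvexOn (realBall d r) f) : IsPositiveKernel c where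
  hermitian α β := by
    rw [coeff_adjoint h hr hf.1]
    simp [Word.adj]
  nonneg := form_re_nonneg h hr hf

end Coefficients

/-! ### The operators on the Hilbert space -/

/-- A symmetric operator with bounded moments at `ξ` is contractive at `ξ`: the norms of the
iterates are logarithmically convex. -/
theorem _root_.LinearMap.IsSymmetric.norm_apply_le_of_bounded {E : Type*}
    [SeminormedAddCommGroup E] [InnerProductSpace ℂ E] {A : E →ₗ[ℂ] E} (hA : A.IsSymmetric)
    {ξ : E} {C : ℝ} (hC : ∀ k, ‖inner ℂ ξ ((A ^ k) ξ)‖ ≤ C) : ‖A ξ‖ ≤ ‖ξ‖ := by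
  have hbd : ∀ k, ‖(A ^ k) ξ‖ ^ 2 ≤ C := fun k => by
    rw [← inner_self_eq_norm_sq (𝕜 := ℂ), hA.pow k ξ, ← Module.End.mul_apply, ← pow_add]
    exact (RCLike.re_le_norm _).trans (hC _)
  have hlog : ∀ k, ‖(A ^ (k + 1)) ξ‖ ^ 2 ≤ ‖(A ^ k) ξ‖ * ‖(A ^ (k + 2)) ξ‖ := fun k => by
    rw [← inner_self_eq_norm_sq (𝕜 := ℂ)]
    have : inner ℂ ((A ^ (k + 1)) ξ) ((A ^ (k + 1)) ξ) =
        inner ℂ ((A ^ k) ξ) ((A ^ (k + 2)) ξ) := by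
      rw [pow_succ' A (k + 1), pow_succ' A k, Module.End.mul_apply, hA, Module.End.mul_apply,
        Module.End.mul_apply]
    rw [this]
    exact (RCLike.re_le_norm _).trans (norm_inner_le_norm _ _)
  -- If the first ratio of consecutive norms exceeds one, logarithmic convexity keeps all later
  -- ratios at least as large, and geometric growth contradicts the moment bound.
  by_contra! hlt
  have h0 : 0 < ‖ξ‖ := by
    refine lt_of_le_of_ne (norm_nonneg _) fun h => ?_
    have h1 := hlog 0
    simp only [zero_add, pow_one, pow_zero, Module.End.one_apply, ← h, zero_mul] at h1
    rw [← h] at hlt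
    nlinarith
  set q := ‖A ξ‖ / ‖ξ‖ with hq
  have hq1 : 1 < q := (one_lt_div h0).2 hlt
  have hgrow : ∀ k, 0 < ‖(A ^ k) ξ‖ ∧ q * ‖(A ^ k) ξ‖ ≤ ‖(A ^ (k + 1)) ξ‖ := by
    intro k
    induction k with
    | zero =>
      refine ⟨by simpa using h0, le_of_eq ?_⟩
      simp [hq, h0.ne']
    | succ k ih =>
      have hpos : 0 < ‖(A ^ (k + 1)) ξ‖ := lt_of_lt_of_le (mul_pos (by linarith) ih.1) ih.2
      refine ⟨hpos, ?_⟩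
      have h1 := hlog k
      have h2 : ‖(A ^ k) ξ‖ * (q * ‖(A ^ (k + 1)) ξ‖) ≤ ‖(A ^ k) ξ‖ * ‖(A ^ (k + 2)) ξ‖ := by
        refine le_trans ?_ h1
        rw [pow_two, ← mul_assoc, mul_comm _ q]
        exact mul_le_mul_of_nonneg_right ih.2 hpos.le
      exact le_of_mul_le_mul_left h2 ih.1
  have hexp : ∀ k, q ^ k * ‖ξ‖ ≤ ‖(A ^ k) ξ‖ := by
    intro k
    induction k with
    | zero => simp
    | succ k ih =>
      rw [pow_succ', mul_assoc]
      exact (mul_le_mul_of_nonneg_left ih (by linarith)).trans (hgrow k).2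
  obtain ⟨k, hk⟩ := pow_unbounded_of_one_lt ((C + 1) / ‖ξ‖) hq1
  have h1 : C + 1 < ‖(A ^ k) ξ‖ := lt_of_lt_of_le ((div_lt_iff₀ h0).1 hk) (hexp k)
  have h2 := hbd k
  have h3 : 0 ≤ C := (sq_nonneg _).trans h2
  nlinarith

section Form

variable {d : ℕ} {K : Type*} [NormedAddCommGroup K] [InnerProductSpace ℂ K]

theorem form_mapDomain_right (c : Word d → K →L[ℂ] K) (g : PosWord d → PosWord d)
    (ξ η : PosWord d →₀ K) : form c ξ (Finsupp.mapDomain g η) =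
      ξ.sum fun β w => η.sum fun α v => inner ℂ w (c (β.1.adj ++ (g α).1) v) := by
  unfold form
  refine Finsupp.sum_congr fun β _ => ?_
  rw [Finsupp.sum_mapDomain_index] <;> simp

theorem form_mapDomain_left (c : Word d → K →L[ℂ] K) (g : PosWord d → PosWord d)
    (ξ η : PosWord d →₀ K) : form c (Finsupp.mapDomain g ξ) η =
      ξ.sum fun β w => η.sum fun α v => inner ℂ w (c ((g β).1.adj ++ α.1) v) := by
  unfold form
  rw [Finsupp.sum_mapDomain_index] <;> simp

end Form

section Operators

variable {d : ℕ} {K : Type*} [NormedAddCommGroup K] [InnerProductSpace ℂ K] [CompleteSpace K]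
  {c : Word d → K →L[ℂ] K} (h : IsPositiveKernel c)

/-- Finite sums of symbols as elements of the semi-inner product space. -/
def ofFinsupp : (PosWord d →₀ K) ≃ₗ[ℂ] PreSpace h :=
  LinearEquiv.refl ℂ (PosWord d →₀ K)

theorem inner_ofFinsupp (ξ η : PosWord d →₀ K) :
    inner ℂ (ofFinsupp h ξ) (ofFinsupp h η) = form c ξ η := rfl

theorem vec_eq_coe (α : PosWord d) (v : K) :
    vec h α v = (ofFinsupp h (Finsupp.single α v) : Space h) := rfl

/-- Left multiplication by `x_i` on finite sums of symbols. -/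
def preShift (i : Fin d) : PreSpace h →ₗ[ℂ] PreSpace h :=
  (ofFinsupp h).toLinearMap ∘ₗ Finsupp.lmapDomain K ℂ (PosWord.cons i) ∘ₗ
    (ofFinsupp h).symm.toLinearMap

theorem preShift_ofFinsupp (i : Fin d) (ξ : PosWord d →₀ K) :
    preShift h i (ofFinsupp h ξ) = ofFinsupp h (Finsupp.mapDomain (PosWord.cons i) ξ) := by
  simp [preShift]

/-- Both sides have the coefficient `c_{β* x_i α}`, since `(x_i β)* = β* x_i`. -/
theorem preShift_isSymmetric (i : Fin d) : (preShift h i).IsSymmetric := by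
  intro ξ η
  obtain ⟨ξ, rfl⟩ := (ofFinsupp h).surjective ξ
  obtain ⟨η, rfl⟩ := (ofFinsupp h).surjective η
  rw [preShift_ofFinsupp, preShift_ofFinsupp, inner_ofFinsupp, inner_ofFinsupp,
    form_mapDomain_left, form_mapDomain_right]
  simp [PosWord.cons, Word.adj]

theorem preShift_pow_ofFinsupp (i : Fin d) (k : ℕ) (ξ : PosWord d →₀ K) :
    (preShift h i ^ k) (ofFinsupp h ξ) =
      ofFinsupp h (Finsupp.mapDomain (PosWord.cons i)^[k] ξ) := by
  induction k with
  | zero => simp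
  | succ k ih =>
    rw [pow_succ', Module.End.mul_apply, ih, preShift_ofFinsupp, Function.iterate_succ',
      Finsupp.mapDomain_comp]

/-- The `k`-th moment at a finite sum involves only the coefficients `c_{β* x_i^k α}`, which are
bounded uniformly in `k`. -/
theorem norm_preShift_le {C : ℝ} (hC : ∀ α, ‖c α‖ ≤ C) (i : Fin d) (ξ : PreSpace h) :
    ‖preShift h i ξ‖ ≤ ‖ξ‖ := by
  obtain ⟨ξ, rfl⟩ := (ofFinsupp h).surjective ξ
  refine (preShift_isSymmetric h i).norm_apply_le_of_bounded
    (C := ∑ β ∈ ξ.support, ∑ α ∈ ξ.support, ‖ξ β‖ * (C * ‖ξ α‖)) fun k => ?_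
  rw [preShift_pow_ofFinsupp, inner_ofFinsupp, form_mapDomain_right]
  refine norm_sum_le_of_le _ fun β _ => norm_sum_le_of_le _ fun α _ => ?_
  refine (norm_inner_le_norm _ _).trans ?_
  gcongr
  exact (c _).le_of_opNorm_le (hC _) _

/-- Left multiplication by `x_i` on the Hilbert space. -/
def shift {C : ℝ} (hC : ∀ α, ‖c α‖ ≤ C) (i : Fin d) : Space h →L[ℂ] Space h :=
  ((preShift h i).mkContinuous 1 fun ξ => by
    simpa using norm_preShift_le h hC i ξ).completion

theorem shift_coe {C : ℝ} (hC : ∀ α, ‖c α‖ ≤ C) (i : Fin d) (ξ : PreSpace h) :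
    shift h hC i (ξ : Space h) = (preShift h i ξ : Space h) := by
  simp [shift]

theorem shift_vec {C : ℝ} (hC : ∀ α, ‖c α‖ ≤ C) (i : Fin d) (α : PosWord d) (v : K) :
    shift h hC i (vec h α v) = vec h (PosWord.cons i α) v := by
  rw [vec_eq_coe, shift_coe, preShift_ofFinsupp, Finsupp.mapDomain_single, vec_eq_coe]

theorem norm_shift_le {C : ℝ} (hC : ∀ α, ‖c α‖ ≤ C) (i : Fin d) : ‖shift h hC i‖ ≤ 1 := by
  refine ContinuousLinearMap.opNorm_le_bound _ zero_le_one fun x => ?_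
  induction x using UniformSpace.Completion.induction_on with
  | hp => exact isClosed_le (by fun_prop) (by fun_prop)
  | ih ξ =>
    rw [shift_coe, one_mul, UniformSpace.Completion.norm_coe, UniformSpace.Completion.norm_coe]
    exact norm_preShift_le h hC i ξ

theorem shift_isSelfAdjoint {C : ℝ} (hC : ∀ α, ‖c α‖ ≤ C) (i : Fin d) :
    IsSelfAdjoint (shift h hC i) := by
  rw [ContinuousLinearMap.isSelfAdjoint_iff_isSymmetric]
  intro x y
  induction x, y using UniformSpace.Completion.induction_on₂ with
  | hp => exact isClosed_eq (by simp; fun_prop) (by simp; fun_prop)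
  | ih ξ η =>
    simp only [ContinuousLinearMap.coe_coe, shift_coe, UniformSpace.Completion.inner_coe]
    exact preShift_isSymmetric h i ξ η

theorem norm_vec_le (α : PosWord d) (v : K) :
    ‖vec h α v‖ ≤ √‖c (α.1.adj ++ α.1)‖ * ‖v‖ := by
  rw [← Real.sqrt_sq (norm_nonneg v), ← Real.sqrt_mul (norm_nonneg _)]
  refine Real.le_sqrt_of_sq_le ?_
  rw [← inner_self_eq_norm_sq (𝕜 := ℂ), inner_vec]
  refine (RCLike.re_le_norm _).trans ((norm_inner_le_norm _ _).trans ?_)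
  calc ‖v‖ * ‖c (α.1.adj ++ α.1) v‖ ≤ ‖v‖ * (‖c (α.1.adj ++ α.1)‖ * ‖v‖) := by
        gcongr; exact ContinuousLinearMap.le_opNorm _ _
    _ = _ := by ring

/-- The map `v ↦ α ⊗ v` from `K` to the Hilbert space. -/
def vecL (α : PosWord d) : K →L[ℂ] Space h :=
  LinearMap.mkContinuous
    ((UniformSpace.Completion.toComplₗᵢ (𝕜 := ℂ) (E := PreSpace h)).toLinearMap ∘ₗ
      ((ofFinsupp h).toLinearMap ∘ₗ Finsupp.lsingle α)) _ (norm_vec_le h α)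

theorem vecL_apply (α : PosWord d) (v : K) : vecL h α v = vec h α v := rfl

end Operators

/-! ### Sums over the words of a given degree -/

section WordSums

variable {d : ℕ} {M : Type*} [AddCommMonoid M]

theorem sum_ofFn_succ_concat (k : ℕ) (g : Word d → M) :
    ∑ φ : Fin (k + 1) → Fin d, g (List.ofFn φ) =
      ∑ i, ∑ φ : Fin k → Fin d, g (List.ofFn φ ++ [i]) := by
  rw [← Fintype.sum_prod_type', ← (Fin.snocEquiv fun _ : Fin (k + 1) => Fin d).sum_comp]
  refine Fintype.sum_congr _ _ fun x => ?_
  rw [List.ofFn_succ']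
  simp [Fin.snocEquiv]

theorem sum_ofFn_succ_cons (k : ℕ) (g : Word d → M) :
    ∑ φ : Fin (k + 1) → Fin d, g (List.ofFn φ) =
      ∑ i, ∑ φ : Fin k → Fin d, g (i :: List.ofFn φ) := by
  rw [← Fintype.sum_prod_type', ← (Fin.consEquiv fun _ : Fin (k + 1) => Fin d).sum_comp]
  refine Fintype.sum_congr _ _ fun x => ?_
  rw [List.ofFn_succ]
  simp [Fin.consEquiv]

theorem hasSum_degree {E : Type*} [NormedAddCommGroup E] {g : Word d → E} {a : E}
    (h : HasSum g a) : HasSum (fun k => ∑ φ : Fin k → Fin d, g (List.ofFn φ)) a := by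
  have h1 : HasSum (fun x : Σ k, Fin k → Fin d => g (List.ofFn x.2)) a :=
    (List.equivSigmaTuple (α := Fin d)).symm.hasSum_iff.2 h
  exact h1.sigma fun k => hasSum_fintype _

/-- For fixed `β`, `α` and `k`, the words `β φ α` are distinct, so their weighted norms form part of
the full series. The resulting bound does not depend on `k`. -/
theorem sum_ofFn_norm_le {E : Type*} [NormedAddCommGroup E] {c : Word d → E} {ρ : ℝ} (hρ : 0 < ρ)
    (hc : Summable fun α => ‖c α‖ * ρ ^ α.length) (β α : Word d) (k : ℕ) :
    (∑ φ : Fin k → Fin d, ‖c (β ++ (List.ofFn φ ++ α))‖) * ρ ^ k ≤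
      (ρ ^ (β.length + α.length))⁻¹ * ∑' w, ‖c w‖ * ρ ^ w.length := by
  have hinj : Function.Injective fun φ : Fin k → Fin d => β ++ (List.ofFn φ ++ α) := by
    intro φ ψ hφ
    exact List.ofFn_injective (List.append_cancel_right (List.append_cancel_left hφ))
  have h2 := hc.sum_le_tsum (Finset.univ.map ⟨_, hinj⟩) (fun _ _ => by positivity)
  rw [Finset.sum_map] at h2
  rw [← div_eq_inv_mul, le_div_iff₀ (by positivity)]
  refine le_trans (le_of_eq ?_) h2
  rw [mul_assoc, ← pow_add, Finset.sum_mul]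
  refine Finset.sum_congr rfl fun φ _ => ?_
  simp only [Function.Embedding.coeFn_mk, List.length_append, List.length_ofFn]
  congr 2
  omega

end WordSums

/-! ### Elementary tensors and the linear pencil -/

section Pencil

variable {H : Type*} [NormedAddCommGroup H] [InnerProductSpace ℂ H] {d n : ℕ}

/-- The elementary tensor `x ⊗ y`. -/
def elemTens (x : H) (y : EuclideanSpace ℂ (Fin n)) : Amp H n := WithLp.toLp 2 fun j => y j • x

theorem elemTens_apply (x : H) (y : EuclideanSpace ℂ (Fin n)) (j : Fin n) :
    elemTens x y j = y j • x := rfl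

theorem tens_elemTens (A : H →L[ℂ] H) (Z : Matrix (Fin n) (Fin n) ℂ) (x : H)
    (y : EuclideanSpace ℂ (Fin n)) :
    tens A Z (elemTens x y) = elemTens (A x) ((EuclideanSpace.equiv (Fin n) ℂ).symm
      (Z.mulVec y)) := by
  ext i
  simp [tens_apply, elemTens_apply, Matrix.mulVec, dotProduct, Finset.sum_smul, smul_smul]

theorem inner_elemTens (x x' : H) (y y' : EuclideanSpace ℂ (Fin n)) :
    inner ℂ (elemTens x y) (elemTens x' y') = inner ℂ y y' * inner ℂ x x' := by
  simp only [PiLp.inner_apply, elemTens_apply, inner_smul_left, inner_smul_right, Finset.sum_mul]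
  refine Finset.sum_congr rfl fun i _ => ?_
  simp
  ring

theorem continuous_elemTens (y : EuclideanSpace ℂ (Fin n)) :
    Continuous fun x : H => elemTens x y :=
  (PiLp.continuous_toLp 2 _).comp (by fun_prop)

theorem eq_sum_elemTens (z : Amp H n) :
    z = ∑ j, elemTens (z j) (EuclideanSpace.single j (1 : ℂ)) := by
  ext i
  simp [elemTens_apply, PiLp.single_apply, Finset.sum_apply, ite_smul]

/-- The linear pencil `∑ T_i ⊗ Z_i`. -/
def pencil (T : Fin d → H →L[ℂ] H) (Z : Tuple d n) : Amp H n →L[ℂ] Amp H n :=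
  ∑ i, tens (T i) (Z i)

theorem pencil_smul (T : Fin d → H →L[ℂ] H) (s : ℂ) (Z : Tuple d n) :
    pencil T (s • Z) = s • pencil T Z := by
  simp [pencil, tens_smul_right, Finset.smul_sum]

theorem pencil_elemTens (T : Fin d → H →L[ℂ] H) (Z : Tuple d n) (x : H)
    (y : EuclideanSpace ℂ (Fin n)) :
    pencil T Z (elemTens x y) =
      ∑ i, elemTens (T i x) ((EuclideanSpace.equiv (Fin n) ℂ).symm ((Z i).mulVec y)) := by
  simp [pencil, tens_elemTens]

theorem adjoint_pencil [CompleteSpace H] {T : Fin d → H →L[ℂ] H} (hT : ∀ i, IsSelfAdjoint (T i))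
    (Z : Tuple d n) : ContinuousLinearMap.adjoint (pencil T Z) =
      pencil T fun i => (Z i).conjTranspose := by
  simp only [pencil, map_sum, adjoint_tens, (hT _).adjoint_eq]

end Pencil

/-! ### Contractivity of the pencil -/

section Bound

variable {d n : ℕ} {K : Type*} [NormedAddCommGroup K] [InnerProductSpace ℂ K] [CompleteSpace K]
  {c : Word d → K →L[ℂ] K} (h : IsPositiveKernel c)

/-- The span of the elementary tensors of symbols with vectors. -/
def symbolSpan (n : ℕ) : Submodule ℂ (Amp (Space h) n) :=
  Submodule.span ℂ {z | ∃ α v y, z = elemTens (vec h α v) y}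

theorem dense_symbolSpan (n : ℕ) : Dense (symbolSpan h n : Set (Amp (Space h) n)) := by
  rw [Submodule.dense_iff_topologicalClosure_eq_top, Submodule.eq_top_iff']
  intro z
  rw [eq_sum_elemTens z]
  refine Submodule.sum_mem _ fun j _ => ?_
  generalize (EuclideanSpace.single j (1 : ℂ)) = y
  generalize z j = x
  induction x using UniformSpace.Completion.induction_on with
  | hp => exact (Submodule.isClosed_topologicalClosure _).preimage (continuous_elemTens y)
  | ih ξ =>
    refine Submodule.le_topologicalClosure _ ?_
    obtain ⟨ξ, rfl⟩ := (ofFinsupp h).surjective ξ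
    induction ξ using Finsupp.induction_linear with
    | zero =>
      convert (symbolSpan h n).zero_mem
      ext i
      simp [elemTens_apply, UniformSpace.Completion.coe_zero]
    | add ξ η h1 h2 =>
      convert (symbolSpan h n).add_mem h1 h2
      ext i
      simp [elemTens_apply, UniformSpace.Completion.coe_add]
    | single α v => exact Submodule.subset_span ⟨α, v, y, rfl⟩

variable {T : Fin d → Space h →L[ℂ] Space h}

/-- The bound for products of `k` pencils at elementary tensors of symbols. -/
def WordBound (ρ : ℝ) (k : ℕ) (B : Amp (Space h) n →L[ℂ] Amp (Space h) n) : Prop :=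
  ∀ (β : PosWord d) (v' : K) (y' : EuclideanSpace ℂ (Fin n)) (α : PosWord d) (v : K)
    (y : EuclideanSpace ℂ (Fin n)),
    ‖inner ℂ (elemTens (vec h β v') y') (B (elemTens (vec h α v) y))‖ ≤
      (∑ φ : Fin k → Fin d, ‖c (β.1.adj ++ (List.ofFn φ ++ α.1))‖) * ρ ^ k *
        (‖y‖ * (‖y'‖ * ‖v'‖ * ‖v‖))

theorem wordBound_one (ρ : ℝ) : WordBound h ρ 0 (1 : Amp (Space h) n →L[ℂ] Amp (Space h) n) := by
  intro β v' y' α v y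
  rw [one_apply_eq_self, inner_elemTens, norm_mul, inner_vec]
  have h1 := norm_inner_le_norm (𝕜 := ℂ) y' y
  have h2 := norm_inner_le_norm (𝕜 := ℂ) v' (c (β.1.adj ++ α.1) v)
  have h3 := (c (β.1.adj ++ α.1)).le_opNorm v
  calc _ ≤ (‖y'‖ * ‖y‖) * (‖v'‖ * (‖c (β.1.adj ++ α.1)‖ * ‖v‖)) := by
        gcongr
        exact h2.trans (by gcongr)
    _ = _ := by simp; ring

variable {h}

/-- The new factor acts first: it puts a letter in front of `α` and costs a factor `ρ` on `y`. The
tuple may change from factor to factor, so `Z` and its adjoint can alternate. -/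
theorem WordBound.mul_pencil {ρ : ℝ} (hρ : 0 ≤ ρ) {k : ℕ}
    {B : Amp (Space h) n →L[ℂ] Amp (Space h) n}
    (hB : WordBound h ρ k B) (hT : ∀ i α v, T i (vec h α v) = vec h (PosWord.cons i α) v)
    {Z : Tuple d n} (hZ : ∀ i, ‖Z i‖ ≤ ρ) : WordBound h ρ (k + 1) (B * pencil T Z) := by
  intro β v' y' α v y
  rw [mul_apply_eq_comp, pencil_elemTens, map_sum, inner_sum,
    sum_ofFn_succ_concat k (fun w => ‖c (β.1.adj ++ (w ++ α.1))‖), Finset.sum_mul, Finset.sum_mul]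
  refine norm_sum_le_of_le _ fun i _ => ?_
  rw [hT]
  refine (hB β v' y' _ v _).trans ?_
  have h1 : ‖(EuclideanSpace.equiv (Fin n) ℂ).symm ((Z i).mulVec y)‖ ≤ ρ * ‖y‖ :=
    (Matrix.l2_opNorm_mulVec (Z i) y).trans (by gcongr; exact hZ i)
  calc _ ≤ (∑ φ : Fin k → Fin d, ‖c (β.1.adj ++ (List.ofFn φ ++ (PosWord.cons i α).1))‖) * ρ ^ k *
        (ρ * ‖y‖ * (‖y'‖ * ‖v'‖ * ‖v‖)) := by gcongr
    _ = _ := by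
      simp only [PosWord.cons, List.append_assoc, List.cons_append, List.nil_append]
      ring

/-- Self-adjointness of the `T_i` makes the adjoint of the pencil a pencil in the tuple of adjoints,
so powers of `P* P` are products of pencils whose moments the coefficient series controls.
Contractivity of `P* P` on a dense span yields that of `P`. -/
theorem norm_pencil_le_one {ρ : ℝ} (hρ : 0 < ρ)
    (hc : Summable fun α => ‖c α‖ * ρ ^ α.length)
    (hT : ∀ i α v, T i (vec h α v) = vec h (PosWord.cons i α) v)
    (hsa : ∀ i, IsSelfAdjoint (T i)) {Z : Tuple d n} (hZ : ∀ i, ‖Z i‖ ≤ ρ) :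
    ‖pencil T Z‖ ≤ 1 := by
  set P := pencil T Z with hP
  set P' := pencil T fun i => (Z i).conjTranspose with hP'
  have hadj : ContinuousLinearMap.adjoint P = P' := adjoint_pencil hsa Z
  set A := P' * P with hA
  have hAk : ∀ k, WordBound h ρ (2 * k) (A ^ k) := by
    intro k
    induction k with
    | zero => exact wordBound_one h ρ
    | succ k ih =>
      rw [pow_succ, hA, ← mul_assoc]
      refine (ih.mul_pencil hρ.le hT fun i => ?_).mul_pencil hρ.le hT hZ
      rw [Matrix.l2_opNorm_conjTranspose]
      exact hZ i
  have hbd : ∀ z ∈ symbolSpan h n, ∀ z' ∈ symbolSpan h n,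
      ∃ C, ∀ k, ‖inner ℂ z ((A ^ k) z')‖ ≤ C := by
    intro z hz z' hz'
    induction hz, hz' using Submodule.span_induction₂ with
    | mem_mem x y hx hy =>
      obtain ⟨β, v', y', rfl⟩ := hx
      obtain ⟨α, v, y, rfl⟩ := hy
      -- The weight `ρ^(2k)` is absorbed into the series, leaving a constant independent of `k`.
      refine ⟨_, fun k => (hAk k β v' y' α v y).trans
        (mul_le_mul_of_nonneg_right (sum_ofFn_norm_le hρ hc β.1.adj α.1 (2 * k))
          (by positivity))⟩
    | zero_left y hy => exact ⟨0, fun k => by simp⟩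
    | zero_right x hx => exact ⟨0, fun k => by simp⟩
    | add_left x y z hx hy hz h1 h2 =>
      obtain ⟨C, hC⟩ := h1
      obtain ⟨C', hC'⟩ := h2
      exact ⟨C + C', fun k => by
        rw [inner_add_left]; exact (norm_add_le _ _).trans (add_le_add (hC k) (hC' k))⟩
    | add_right x y z hx hy hz h1 h2 =>
      obtain ⟨C, hC⟩ := h1
      obtain ⟨C', hC'⟩ := h2
      exact ⟨C + C', fun k => by
        rw [map_add, inner_add_right]
        exact (norm_add_le _ _).trans (add_le_add (hC k) (hC' k))⟩
    | smul_left r x y hx hy h1 =>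
      obtain ⟨C, hC⟩ := h1
      exact ⟨‖r‖ * C, fun k => by
        rw [inner_smul_left, norm_mul, RCLike.norm_conj]; gcongr; exact hC k⟩
    | smul_right r x y hx hy h1 =>
      obtain ⟨C, hC⟩ := h1
      exact ⟨‖r‖ * C, fun k => by
        rw [map_smul, inner_smul_right, norm_mul]; gcongr; exact hC k⟩
  have hsym : (A : Amp (Space h) n →ₗ[ℂ] Amp (Space h) n).IsSymmetric := by
    intro x y
    change inner ℂ (P' (P x)) y = inner ℂ x (P' (P y))
    rw [← hadj, ContinuousLinearMap.adjoint_inner_left, ContinuousLinearMap.adjoint_inner_right]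
  have hle : ∀ z, ‖A z‖ ≤ ‖z‖ := by
    intro z
    refine (dense_symbolSpan h n).induction (P := fun z => ‖A z‖ ≤ ‖z‖) (fun z hz => ?_)
      (isClosed_le (by fun_prop) (by fun_prop)) z
    obtain ⟨C, hC⟩ := hbd z hz z hz
    refine hsym.norm_apply_le_of_bounded (C := C) fun k => ?_
    rw [← ContinuousLinearMap.toLinearMap_pow]
    exact hC k
  refine ContinuousLinearMap.opNorm_le_bound _ zero_le_one fun x => ?_
  rw [one_mul]
  refine (pow_le_pow_iff_left₀ (norm_nonneg _) (norm_nonneg x) two_ne_zero).1 ?_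
  have h1 : inner ℂ (P x) (P x) = inner ℂ x (A x) := by
    change _ = inner ℂ x (P' (P x))
    rw [← hadj, ContinuousLinearMap.adjoint_inner_right]
  rw [← inner_self_eq_norm_sq (𝕜 := ℂ), h1, pow_two]
  refine (RCLike.re_le_norm _).trans ((norm_inner_le_norm _ _).trans ?_)
  gcongr
  exact hle x

theorem norm_pencil_lt_one {r : ℝ} (hr : 0 < r)
    (hc : ∀ ρ, 0 ≤ ρ → ρ < r → Summable fun α => ‖c α‖ * ρ ^ α.length)
    (hT : ∀ i α v, T i (vec h α v) = vec h (PosWord.cons i α) v)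
    (hsa : ∀ i, IsSelfAdjoint (T i)) {Z : Tuple d n} (hZ : Z ∈ complexBall d r n) :
    ‖pencil T Z‖ < 1 := by
  have h1 : ∀ᶠ ρ in 𝓝[<] r, 0 < ρ ∧ ∀ i, ‖Z i‖ < ρ :=
    nhdsWithin_le_nhds ((lt_mem_nhds hr).and (eventually_all.2 fun i => lt_mem_nhds (hZ i)))
  obtain ⟨ρ, ⟨h0, hρ⟩, hρr⟩ := (h1.and self_mem_nhdsWithin).exists
  -- The tuple scaled by `σ / ρ > 1` still has norms at most `σ < r`, so its pencil is contractive;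
  -- undoing the scaling gives the strict inequality.
  obtain ⟨σ, hσ, hσr⟩ := exists_between (show ρ < r from hρr)
  have hσ0 : 0 < σ := h0.trans hσ
  have h2 := norm_pencil_le_one hσ0 (hc σ hσ0.le hσr) hT hsa
    (Z := ((σ / ρ : ℝ) : ℂ) • Z) (fun i => by
      rw [Pi.smul_apply, norm_smul, Complex.norm_real, Real.norm_eq_abs,
        abs_of_pos (by positivity), div_mul_eq_mul_div, div_le_iff₀ h0]
      gcongr
      exact (hρ i).le)
  rw [pencil_smul, norm_smul, Complex.norm_real, Real.norm_eq_abs,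
    abs_of_pos (by positivity), div_mul_eq_mul_div, div_le_iff₀ h0, one_mul] at h2
  by_contra! h3
  nlinarith

end Bound

/-! ### The realization -/

section Realization

variable {d n : ℕ}

theorem pencil_pow {H : Type*} [NormedAddCommGroup H] [InnerProductSpace ℂ H]
    (T : Fin d → H →L[ℂ] H) (Z : Tuple d n) (k : ℕ) :
    pencil T Z ^ k =
      ∑ φ : Fin k → Fin d, tens ((List.ofFn φ).map T).prod (monomial Z (List.ofFn φ)) := by
  induction k with
  | zero => simp [tens_one]
  | succ k ih =>
    rw [pow_succ, ih, pencil, sum_ofFn_succ_concat k fun w => tens (w.map T).prod (monomial Z w),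
      Finset.sum_mul_sum, Finset.sum_comm]
    refine Finset.sum_congr rfl fun i _ => Finset.sum_congr rfl fun φ _ => ?_
    rw [ContinuousLinearMap.mul_def, tens_comp, monomial_append, List.map_append, List.prod_append]
    simp [ContinuousLinearMap.mul_def]

variable {K : Type*} [NormedAddCommGroup K] [InnerProductSpace ℂ K] [CompleteSpace K]
  {c : Word d → K →L[ℂ] K} {h : IsPositiveKernel c} {T : Fin d → Space h →L[ℂ] Space h}

theorem prod_map_vec (hT : ∀ i α v, T i (vec h α v) = vec h (PosWord.cons i α) v) (w : Word d)
    (α : PosWord d) (v : K) :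
    (w.map T).prod (vec h α v) = vec h ⟨w ++ α.1, by simp [α.2]⟩ v := by
  induction w with
  | nil => simp
  | cons i w ih =>
    rw [List.map_cons, List.prod_cons, mul_apply_eq_comp, ih, hT]
    rfl

theorem adjoint_comp_prod_comp (hT : ∀ i α v, T i (vec h α v) = vec h (PosWord.cons i α) v)
    {Q : Fin d → K →L[ℂ] Space h} (hQ : ∀ i v, Q i v = vec h (PosWord.letter i) v)
    (i j : Fin d) (w : Word d) :
    ContinuousLinearMap.adjoint (Q i) ∘L (w.map T).prod ∘L Q j = c (i :: w ++ [j]) := by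
  ext v
  refine ext_inner_left ℂ fun v' => ?_
  rw [ContinuousLinearMap.comp_apply, ContinuousLinearMap.adjoint_inner_right,
    ContinuousLinearMap.comp_apply, hQ, hQ, prod_map_vec hT, inner_vec]
  simp [PosWord.letter, Word.adj]

/-- Each word of length `k + 2` is uniquely `x_i w x_j` with `w` of length `k`. The adjoint in the
left factor is offset by the conjugate transposes, so the term is holomorphic in `Z`. -/
theorem comp_pencil_pow_comp (hT : ∀ i α v, T i (vec h α v) = vec h (PosWord.cons i α) v)
    {Q : Fin d → K →L[ℂ] Space h} (hQ : ∀ i v, Q i v = vec h (PosWord.letter i) v)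
    (Z : Tuple d n) (k : ℕ) :
    ContinuousLinearMap.adjoint (∑ i, tens (Q i) (Z i).conjTranspose) ∘L (pencil T Z ^ k) ∘L
        (∑ i, tens (Q i) (Z i)) =
      ∑ φ : Fin (k + 2) → Fin d, tens (c (List.ofFn φ)) (monomial Z (List.ofFn φ)) := by
  rw [sum_ofFn_succ_concat (k + 1) fun w => tens (c w) (monomial Z w)]
  rw [pencil_pow]
  simp only [map_sum, adjoint_tens, Matrix.conjTranspose_conjTranspose,
    ContinuousLinearMap.finsetSum_comp, ContinuousLinearMap.comp_finsetSum, tens_comp,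
    adjoint_comp_prod_comp hT hQ]
  refine Finset.sum_congr rfl fun j _ => ?_
  rw [sum_ofFn_succ_cons k fun w => tens (c (w ++ [j])) (monomial Z (w ++ [j])), Finset.sum_comm]
  refine Finset.sum_congr rfl fun i _ => Finset.sum_congr rfl fun φ _ => ?_
  simp [monomial_append]

theorem hasSum_geometric_inverse {R : Type*} [NormedRing R] [CompleteSpace R] {x : R}
    (hx : ‖x‖ < 1) : HasSum (fun k : ℕ => x ^ k) (Ring.inverse (1 - x)) := by
  rw [NormedRing.inverse_one_sub x hx]
  exact (summable_geometric_of_norm_lt_one hx).hasSum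

theorem realization {f : GradedFun d K} {r : ℝ} (hconv : ConvergesAbsUnif c f r)
    (hT : ∀ i α v, T i (vec h α v) = vec h (PosWord.cons i α) v)
    {Q : Fin d → K →L[ℂ] Space h} (hQ : ∀ i v, Q i v = vec h (PosWord.letter i) v)
    {Z : Tuple d n} (hZ : Z ∈ complexBall d r n) (hlt : ‖pencil T Z‖ < 1) :
    f n Z = tens (c []) 1 + ∑ i, tens (c [i]) (Z i) +
      ContinuousLinearMap.adjoint (∑ i, tens (Q i) (Z i).conjTranspose) ∘L
        Ring.inverse (1 - pencil T Z) ∘L (∑ i, tens (Q i) (Z i)) := by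
  set V := ContinuousLinearMap.adjoint (∑ i, tens (Q i) (Z i).conjTranspose)
  set U := ∑ i, tens (Q i) (Z i)
  -- Grouping by degree and dropping degrees zero and one leaves the series that the Neumann
  -- expansion produces.
  have h1 := (hasSum_nat_add_iff' 2).2 (hasSum_degree (hconv.hasSum hZ))
  have h2 := (hasSum_geometric_inverse hlt).mapL
    ((ContinuousLinearMap.compL ℂ (Amp K n) (Amp (Space h) n) (Amp (Space h) n)).flip U)
  have h3 := h2.mapL (ContinuousLinearMap.compL ℂ (Amp K n) (Amp (Space h) n) (Amp K n) V)
  simp only [ContinuousLinearMap.compL_apply, ContinuousLinearMap.flip_apply] at h3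
  have h4 : ∀ k, V ∘L (pencil T Z ^ k) ∘L U = _ := comp_pencil_pow_comp hT hQ Z
  simp only [h4] at h3
  have h5 := h1.unique h3
  rw [← h5, Finset.sum_range_succ, Finset.sum_range_one,
    sum_ofFn_succ_concat 0 fun w => tens (c w) (monomial Z w)]
  simp

end Realization

end Butterfly
end

/-! ### Assembly of the theorem -/

open Butterfly
theorem mainTheorem7 {d : ℕ} {K : Type*} [NormedAddCommGroup K] [InnerProductSpace ℂ K]
    [CompleteSpace K] (ε : ℝ) (hε : 0 < ε)
    (c : Word d → K →L[ℂ] K) (f : GradedFun d K)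
    (hconv : ConvergesAbsUnif c f (1 + ε))
    (hf : MatrixConvexOn (realBall d (1 + ε)) f) :
    -- the block matrix is positive, so it defines the Hilbert space `Space h`
    ∃ h : IsPositiveKernel c,
    ∃ (T : Fin d → Space h →L[ℂ] Space h) (Q : Fin d → K →L[ℂ] Space h),
      (∀ i α v, T i (vec h α v) = vec h (PosWord.cons i α) v) ∧
      (∀ i v, Q i v = vec h (PosWord.letter i) v) ∧
      (∀ i, IsSelfAdjoint (T i)) ∧
      (∀ i, ‖T i‖ ≤ 1) ∧
      ∃ (a₀ : K →L[ℂ] K) (L : (Fin d → ℝ) →L[ℝ] (K →L[ℂ] K)),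
        IsSelfAdjoint a₀ ∧ (∀ t, IsSelfAdjoint (L t)) ∧
        ∀ n, ∀ Z ∈ complexBall d (1 + ε) n,
          IsUnit (1 - ∑ i, tens (T i) (Z i)) ∧
          f n Z = tens a₀ 1 + ∑ i, tens (L (Pi.single i 1)) (Z i) +
            ContinuousLinearMap.adjoint (∑ i, tens (Q i) (Z i).conjTranspose) ∘L
              Ring.inverse (1 - ∑ i, tens (T i) (Z i)) ∘L
              (∑ i, tens (Q i) (Z i)) := by
  have hr : 0 < 1 + ε := by linarith
  have h := isPositiveKernel hconv hr hf
  -- Radius one lies strictly inside the ball because `ε > 0`; this gives the uniform bound on the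
  -- coefficients needed to define the `T_i`.
  have hsum := hconv.summable_norm zero_le_one (show (1 : ℝ) < 1 + ε by linarith)
  have hC : ∀ α, ‖c α‖ ≤ ∑' α, ‖c α‖ * 1 ^ α.length := fun α => by
    simpa using hsum.le_tsum α fun _ _ => by positivity
  have hT := shift_vec h hC
  have hQ : ∀ i v, vecL h (PosWord.letter i) v = vec h (PosWord.letter i) v := fun i v =>
    vecL_apply h _ v
  have hadj := coeff_adjoint hconv hr hf.1
  refine ⟨h, shift h hC, fun i => vecL h (PosWord.letter i), hT, hQ, shift_isSelfAdjoint h hC,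
    norm_shift_le h hC, c [], ∑ i, (ContinuousLinearMap.proj (R := ℝ) i).smulRight (c [i]),
    hadj [], fun t => ?_, fun n Z hZ => ?_⟩
  · simp only [sum_apply, ContinuousLinearMap.smulRight_apply,
      ContinuousLinearMap.proj_apply]
    exact isSelfAdjoint_sum _ fun i _ => (IsSelfAdjoint.all (t i)).smul (hadj [i])
  · have hlt : ‖pencil (shift h hC) Z‖ < 1 := norm_pencil_lt_one hr
      (fun ρ h0 h1 => hconv.summable_norm h0 h1) hT (shift_isSelfAdjoint h hC) hZ
    refine ⟨isUnit_one_sub_of_norm_lt_one hlt, ?_⟩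
    have hL : ∀ i, (∑ j, (ContinuousLinearMap.proj (R := ℝ) j).smulRight (c [j]) :
        (Fin d → ℝ) →L[ℝ] (K →L[ℂ] K)) (Pi.single i 1) = c [i] := by
      intro i
      simp [Pi.single_apply, ite_smul]
    simp only [hL]
    exact realization hconv hT hQ hZ hlt
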